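/- All graphs are finite and simple, and $\log$ is the natural logarithm. A flow $F$ in a graph $G$ assigns a value $F(P)\ge 0$ to every (directed) simple path $P$ of $G$. It has congestion at most $\eta$ if $\sum_{P\ni e}F(P)\le\eta$ for every edge $e$ of $G$, it has dilation at most $h$ if every $P$ with $F(P)>0$ has at most $h$ edges, and it routes the demand $D_F(u,v)=\sum_{P\text{ from }u\text{ to }v}F(P)$. A matching $M\subseteq E(G)$ (a set of pairwise disjoint edges) is $d$-routable in $G$ with dilation $h$ and congestion $\eta$ if, for every choice of an ordering $(u,v)$ of the endpoints of each edge of $M$, there is a flow in $G$ with dilation at most $h$ and congestion at most $\eta$ with $D_F(u,v)=d$ for each chosen ordered pair $(u,v)$ and $D_F=0$ on all other ordered pairs. There exist universal constants $\Theta,\Theta'>0$ such that the following holds for every real $t\ge 2$ and every integer $n\ge 2$. Let $$\phi=\frac{1}{2t\cdot n^{\Theta/t}\cdot\log n},\qquad \delta=\frac{4\Theta'\cdot t\log n}{\phi^2},\qquad \delta'=\frac{\phi}{2t}\cdot\delta .$$ Then every $n$-vertex graph $H$ of minimum degree at least $\delta$ has a subgraph $H'\subseteq H$ with at least one edge such that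 1. $H'$ has minimum degree at least $\delta'$, and 2. every matching $M\subseteq E(H')$ is $\delta'$-routable in $H'$ with dilation $t$ and congestion $\delta'/2$. -/

import Mathlib

noncomputable section

namespace FlowRouting

open scoped Classical in
/-- The minimum degree of a finite graph. -/
def minDeg {W : Type*} [Finite W] (G : SimpleGraph W) : ℕ :=
  letI := Fintype.ofFinite W
  G.minDegree

/-- A (multicommodity) flow in `G`: a nonnegative value for every simple path of `G`.
A path from `u` to `v` is an element of Mathlib's type `G.Path u v` (walks without repeated
vertices). -/
structure Flow {W : Type*} (G : SimpleGraph W) where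
  /-- the flow value of a simple path -/
  val : ∀ {u v : W}, G.Path u v → ℝ
  nonneg : ∀ {u v : W} (P : G.Path u v), 0 ≤ val P

open scoped Classical in
/-- The congestion of `F` on `e`: the sum of the flow values of all simple paths through `e`. -/
def Flow.congestionOn {W : Type*} [Finite W] {G : SimpleGraph W} (F : Flow G)
    (e : Sym2 W) : ℝ :=
  letI := Fintype.ofFinite W
  ∑ u : W, ∑ v : W, ∑ P : G.Path u v, if e ∈ P.1.edges then F.val P else 0

/-- The flow has congestion at most `η`. -/
def Flow.CongestionLE {W : Type*} [Finite W] {G : SimpleGraph W} (F : Flow G)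
    (η : ℝ) : Prop :=
  ∀ e ∈ G.edgeSet, F.congestionOn e ≤ η

/-- The flow has dilation at most `h`: all its flow-paths have at most `h` edges. -/
def Flow.DilationLE {W : Type*} {G : SimpleGraph W} (F : Flow G) (h : ℝ) : Prop :=
  ∀ (u v : W) (P : G.Path u v), 0 < F.val P → (P.1.length : ℝ) ≤ h

open scoped Classical in
/-- The demand routed by `F`: the total flow value of the simple paths from `u` to `v`. -/
def Flow.demand {W : Type*} [Finite W] {G : SimpleGraph W} (F : Flow G) (u v : W) : ℝ :=
  letI := Fintype.ofFinite W
  ∑ P : G.Path u v, F.val P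

/-- The demand `D` is routable in `G` with congestion `η` and dilation `h`. -/
def Routable {W : Type*} [Finite W] (G : SimpleGraph W) (D : W → W → ℝ) (η h : ℝ) : Prop :=
  ∃ F : Flow G, F.CongestionLE η ∧ F.DilationLE h ∧ ∀ u v, F.demand u v = D u v

/-- `M` is a matching in `G`: a set of pairwise disjoint edges of `G`. -/
def IsMatching {W : Type*} (G : SimpleGraph W) (M : Set (Sym2 W)) : Prop :=
  M ⊆ G.edgeSet ∧ ∀ e ∈ M, ∀ f ∈ M, e ≠ f → ∀ w, ¬ (w ∈ e ∧ w ∈ f)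

/-- `o` picks, for each edge of `M`, an ordering of its two endpoints. -/
def IsOrientation {W : Type*} (M : Set (Sym2 W)) (o : Sym2 W → W × W) : Prop :=
  ∀ e ∈ M, s((o e).1, (o e).2) = e

open scoped Classical in
/-- The demand of a matching `M` whose edges are ordered by `o`: `d` from the first to the second
endpoint of every edge of `M`, and `0` for all other ordered pairs. -/
def matchingDemand {W : Type*} (M : Set (Sym2 W)) (o : Sym2 W → W × W) (d : ℝ) (u v : W) : ℝ :=
  if ∃ e ∈ M, o e = (u, v) then d else 0

/-- The matching `M` is `d`-routable in `G` with congestion `η` and dilation `h`, whatever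
ordering of the endpoints of its edges is fixed. -/
def MatchingRoutable {W : Type*} [Finite W] (G : SimpleGraph W) (M : Set (Sym2 W))
    (d η h : ℝ) : Prop :=
  ∀ o : Sym2 W → W × W, IsOrientation M o → Routable G (matchingDemand M o d) η h

end FlowRouting

end

/-! Among all subgraphs `K` of `H`, take one maximising `|E(K)| - c·Φ(K) - m·|V(K)|`, where `Φ` sums
the logarithms of ball sizes over all vertices and radii `1, …, R` with `2R ≤ t`. Deleting a vertex
cannot increase `Φ`, so maximality forces minimum degree at least `m`. Suppose deleting an edge set
`C` leaves no path of length at most `t` between the ends of any edge of a matching `M'`. For each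
edge `uv` of `M'` the balls around `u` and `v` become disjoint. If no ball of either end had shrunk
noticeably, their sizes would grow by a factor `N` at each radius and exceed `|V| ≤ N^R`. So `Φ`
drops by `log (1 + 1/N)` per matching edge (`sum_ballPotential_drop`), and with `c = 2t / log (1 +
1/N)` maximality gives `|C| ≥ 2t|M'|`. LP duality turns this cut bound into a flow
(`matchingRoutable_of_cut`): for any edge prices, a superlevel set of the prices would be a
forbidden cut unless cheap short paths exist (`exists_cheap_paths`). The large minimum degree of `H`
only serves to make the maximum positive, so that `K` has an edge. -/

noncomputable section

namespace FlowRouting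

/-! ### Duality and layer-cake tools -/

/-- A finite form of the minimax theorem: if against every nonnegative pricing of `E` some row of
`c` is cheap, then some convex combination of the rows is bounded by `η` in every coordinate. -/
theorem exists_convex_combination_le {S E : Type*} [Fintype S] [Fintype E] (c : S → E → ℝ)
    (η : ℝ) (h : ∀ l : E → ℝ, (∀ e, 0 ≤ l e) → ∃ s, ∑ e, l e * c s e ≤ η * ∑ e, l e) :
    ∃ w : S → ℝ, (∀ s, 0 ≤ w s) ∧ ∑ s, w s = 1 ∧ ∀ e, ∑ s, w s * c s e ≤ η := by
  classical
  -- If the hull of the rows misses the orthant below `η`, a separating functional has nonpositive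
  -- coordinates; its negative is a pricing that contradicts `h`.
  by_cases hd : Disjoint (convexHull ℝ (Set.range c)) {b : E → ℝ | ∀ e, b e ≤ η}
  · exfalso
    have hconv : Convex ℝ {b : E → ℝ | ∀ e, b e ≤ η} := by
      intro x hx y hy a b ha hb hab e
      have h1 := mul_le_mul_of_nonneg_left (hx e) ha
      have h2 := mul_le_mul_of_nonneg_left (hy e) hb
      have h3 : a * η + b * η = η := by rw [← add_mul, hab, one_mul]
      simp only [Pi.add_apply, Pi.smul_apply, smul_eq_mul]
      linarith
    have hclosed : IsClosed {b : E → ℝ | ∀ e, b e ≤ η} := by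
      simp only [Set.ofPred_forall]
      exact isClosed_iInter fun e => isClosed_le (continuous_apply e) continuous_const
    obtain ⟨f, u, v, hA, huv, hB⟩ := geometric_hahn_banach_compact_closed
      (convex_convexHull ℝ (Set.range c)) ((Set.finite_range c).isCompact_convexHull ℝ) hconv hclosed hd
    have hf : ∀ b : E → ℝ, f b = ∑ e, b e * f (Pi.single e 1) := by
      intro b
      conv_lhs => rw [pi_eq_sum_univ' b]
      simp [map_sum]
    have hneg : ∀ e, f (Pi.single e 1) ≤ 0 := by
      intro e
      by_contra! hpos
      -- The orthant is unbounded downwards, so a positive coordinate would push `f` below `v` on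
      -- it.
      obtain ⟨k, hk⟩ := exists_nat_gt ((f (fun _ => η) - v) / f (Pi.single e 1))
      have hmem := hB ((fun _ => η) - (k : ℝ) • Pi.single e 1) (by
        intro e'
        have : (0 : ℝ) ≤ k * (Pi.single e (1 : ℝ) : E → ℝ) e' :=
          mul_nonneg (Nat.cast_nonneg k) (by by_cases h : e' = e <;> simp [h])
        simp only [Pi.sub_apply, Pi.smul_apply, smul_eq_mul]
        linarith)
      rw [map_sub, map_smul, smul_eq_mul] at hmem
      rw [div_lt_iff₀ hpos] at hk
      linarith
    obtain ⟨s, hs⟩ := h (fun e => - f (Pi.single e 1)) fun e => neg_nonneg.2 (hneg e)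
    have h1 := hA (c s) (subset_convexHull ℝ _ ⟨s, rfl⟩)
    have h2 := hB (fun _ => η) fun _ => le_rfl
    rw [hf] at h1 h2
    rw [← Finset.mul_sum] at h2
    simp only [neg_mul, Finset.sum_neg_distrib, mul_neg] at hs
    simp only [mul_comm (f _)] at hs
    linarith
  · obtain ⟨b, hb, hb'⟩ := Set.not_disjoint_iff.1 hd
    rw [convexHull_range_eq_exists_affineCombination] at hb
    obtain ⟨T, w, hw, hw1, rfl⟩ := hb
    refine ⟨fun s => if s ∈ T then w s else 0, fun s => ?_, ?_, fun e => ?_⟩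
    · dsimp only
      split_ifs with hs
      exacts [hw s hs, le_rfl]
    · simpa using hw1
    · have := hb' e
      rw [Finset.affineCombination_eq_linear_combination _ _ _ hw1] at this
      simpa [Finset.sum_apply, ite_mul] using this

/-- If one family of numbers has a larger weighted sum than another one, then this is visible in
some superlevel set. -/
theorem exists_threshold {I J : Type*} (A : Finset I) (B : Finset J) (a : I → ℝ) (b : J → ℝ)
    (ha : ∀ i ∈ A, 0 ≤ a i) (hb : ∀ j ∈ B, 0 ≤ b j) (k : ℝ)
    (h : ∑ j ∈ B, b j < k * ∑ i ∈ A, a i) :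
    ∃ θ : ℝ, 0 < θ ∧
      ((B.filter fun j => θ ≤ b j).card : ℝ) < k * (A.filter fun i => θ ≤ a i).card := by
  by_contra! hcon
  -- Layer cake: `x ≥ 0` is the integral over `θ` of the indicator of `(0, x]`, so the reversed
  -- inequality at every `θ` integrates to a contradiction.
  have hint : ∀ x : ℝ, MeasureTheory.Integrable ((Set.Ioc 0 x).indicator (1 : ℝ → ℝ)) := fun x =>
    (MeasureTheory.integrable_indicator_iff measurableSet_Ioc).2
      (MeasureTheory.integrableOn_const (by simp))
  have hval : ∀ x : ℝ, 0 ≤ x → ∫ θ, (Set.Ioc 0 x).indicator (1 : ℝ → ℝ) θ = x := by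
    intro x hx
    rw [MeasureTheory.integral_indicator_one measurableSet_Ioc]
    simp [hx]
  have hA : ∫ θ, k * ∑ i ∈ A, (Set.Ioc 0 (a i)).indicator (1 : ℝ → ℝ) θ = k * ∑ i ∈ A, a i := by
    rw [MeasureTheory.integral_const_mul, MeasureTheory.integral_finsetSum _ fun i _ => hint _]
    rw [Finset.sum_congr rfl fun i hi => hval _ (ha i hi)]
  have hB : ∫ θ, ∑ j ∈ B, (Set.Ioc 0 (b j)).indicator (1 : ℝ → ℝ) θ = ∑ j ∈ B, b j := by
    rw [MeasureTheory.integral_finsetSum _ fun i _ => hint _]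
    exact Finset.sum_congr rfl fun i hi => hval _ (hb i hi)
  rw [← hA, ← hB] at h
  refine absurd h (not_lt.2 (MeasureTheory.integral_mono
    ((MeasureTheory.integrable_finsetSum _ fun i _ => hint _).const_mul _)
    (MeasureTheory.integrable_finsetSum _ fun i _ => hint _) fun θ => ?_))
  by_cases hθ : 0 < θ
  · simpa [Set.indicator_apply, hθ, Finset.sum_boole] using hcon θ hθ
  · simp [hθ]

/-! ### Ball growth and the potential drop -/

open scoped Classical in
/-- The vertices joined to `v` by a walk with at most `r` edges. -/
def hopBall {V : Type*} [Fintype V] (G : SimpleGraph V) (r : ℕ) (v : V) : Finset V :=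
  Finset.univ.filter fun w => ∃ p : G.Walk v w, p.length ≤ r

/-- The logarithms of the sizes of the balls of radius `1, …, R` around `v`, added up. -/
def ballPotential {V : Type*} [Fintype V] (G : SimpleGraph V) (R : ℕ) (v : V) : ℝ :=
  ∑ r ∈ Finset.range R, Real.log (hopBall G (r + 1) v).card

section Balls

variable {V : Type*} [Fintype V]

theorem mem_hopBall {G : SimpleGraph V} {r : ℕ} {v w : V} :
    w ∈ hopBall G r v ↔ ∃ p : G.Walk v w, p.length ≤ r := by
  simp [hopBall]

theorem self_mem_hopBall (G : SimpleGraph V) (r : ℕ) (v : V) : v ∈ hopBall G r v :=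
  mem_hopBall.2 ⟨.nil, by simp⟩

theorem one_le_card_hopBall (G : SimpleGraph V) (r : ℕ) (v : V) :
    (1 : ℝ) ≤ (hopBall G r v).card := by
  exact_mod_cast Finset.card_pos.2 ⟨v, self_mem_hopBall G r v⟩

theorem card_hopBall_le (G : SimpleGraph V) (r : ℕ) (v : V) :
    ((hopBall G r v).card : ℝ) ≤ Fintype.card V := by
  exact_mod_cast Finset.card_le_univ _

theorem hopBall_mono {G G' : SimpleGraph V} (h : G' ≤ G) (r : ℕ) (v : V) :
    hopBall G' r v ⊆ hopBall G r v := by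
  intro w hw
  obtain ⟨p, hp⟩ := mem_hopBall.1 hw
  exact mem_hopBall.2 ⟨p.mapLe h, by simpa using hp⟩

theorem ballPotential_nonneg (G : SimpleGraph V) (R : ℕ) (v : V) : 0 ≤ ballPotential G R v :=
  Finset.sum_nonneg fun _ _ => Real.log_nonneg (one_le_card_hopBall _ _ _)

theorem ballPotential_le (G : SimpleGraph V) (R : ℕ) (v : V) :
    ballPotential G R v ≤ R * Real.log (Fintype.card V) := by
  refine (Finset.sum_le_card_nsmul _ _ (Real.log (Fintype.card V)) fun r _ => ?_).trans_eq (by simp)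
  exact Real.log_le_log (zero_lt_one.trans_le (one_le_card_hopBall _ _ _)) (card_hopBall_le _ _ _)

theorem log_card_hopBall_mono {G G' : SimpleGraph V} (h : G' ≤ G) (r : ℕ) (v : V) :
    Real.log (hopBall G' r v).card ≤ Real.log (hopBall G r v).card :=
  Real.log_le_log (zero_lt_one.trans_le (one_le_card_hopBall _ _ _))
    (by exact_mod_cast Finset.card_le_card (hopBall_mono h r v))

theorem ballPotential_mono {G G' : SimpleGraph V} (h : G' ≤ G) (R : ℕ) (v : V) :
    ballPotential G' R v ≤ ballPotential G R v :=
  Finset.sum_le_sum fun r _ => log_card_hopBall_mono h (r + 1) v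

/-- If `u` and `v` are adjacent in `G` but far apart in `G'`, the ball of `u` shrinks by the ball
of `v` when passing from `G` to `G'`. -/
theorem card_hopBall_add_le {G G' : SimpleGraph V} (h : G' ≤ G) {u v : V} (huv : G.Adj u v)
    {r : ℕ} (hsep : ∀ p : G'.Walk u v, 2 * r + 1 < p.length) :
    (hopBall G' (r + 1) u).card + (hopBall G' r v).card ≤ (hopBall G (r + 1) u).card := by
  classical
  rw [← Finset.card_union_of_disjoint]
  · refine Finset.card_le_card (Finset.union_subset (hopBall_mono h _ _) fun w hw => ?_)
    obtain ⟨p, hp⟩ := mem_hopBall.1 hw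
    exact mem_hopBall.2 ⟨.cons huv (p.mapLe h), by simpa using hp⟩
  · rw [Finset.disjoint_left]
    intro w hw hw'
    obtain ⟨p, hp⟩ := mem_hopBall.1 hw
    obtain ⟨q, hq⟩ := mem_hopBall.1 hw'
    have := hsep (p.append q.reverse)
    rw [SimpleGraph.Walk.length_append, SimpleGraph.Walk.length_reverse] at this
    omega

/-- The disjoint ball of `v` adds at least a `1/K` fraction to the ball of `u`, so one logarithm
gains `log (1 + 1/K)` while the others are monotone. -/
theorem ballPotential_drop {G G' : SimpleGraph V} (h : G' ≤ G) {u v : V} (huv : G.Adj u v)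
    {r R : ℕ} (hr : r < R) (hsep : ∀ p : G'.Walk u v, 2 * r + 1 < p.length) {K : ℝ} (hK : 0 < K)
    (hgrow : ((hopBall G' (r + 1) u).card : ℝ) ≤ K * (hopBall G' r v).card) :
    ballPotential G' R u + Real.log (1 + 1 / K) ≤ ballPotential G R u := by
  have hmem : r ∈ Finset.range R := Finset.mem_range.2 hr
  have key : Real.log (hopBall G' (r + 1) u).card + Real.log (1 + 1 / K) ≤
      Real.log (hopBall G (r + 1) u).card := by
    have h1 := one_le_card_hopBall G' (r + 1) u
    have h2 : (((hopBall G' (r + 1) u).card : ℝ) + (hopBall G' r v).card) ≤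
        (hopBall G (r + 1) u).card := by exact_mod_cast card_hopBall_add_le h huv hsep
    rw [← Real.log_mul (by positivity) (by positivity)]
    refine Real.log_le_log (by positivity) (le_trans ?_ h2)
    have h3 : ((hopBall G' (r + 1) u).card : ℝ) / K ≤ (hopBall G' r v).card :=
      (div_le_iff₀' hK).2 hgrow
    rw [mul_add, mul_one, mul_one_div]
    linarith
  unfold ballPotential
  rw [← Finset.add_sum_erase _ _ hmem, ← Finset.add_sum_erase _ _ hmem]
  have := Finset.sum_le_sum fun i (_ : i ∈ (Finset.range R).erase r) =>
    log_card_hopBall_mono h (i + 1) u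
  linarith

/-- When an edge of `G` gets separated in `G'`, the potential of one of its endpoints drops. -/
theorem exists_ballPotential_drop {G G' : SimpleGraph V} (h : G' ≤ G) {u v : V} (huv : G.Adj u v)
    {R : ℕ} (hR : 0 < R)
    (hsep : ∀ p : G'.Walk u v, 2 * R ≤ p.length) {K : ℝ} (hK : 0 < K)
    (hKR : (Fintype.card V : ℝ) ≤ K ^ R) :
    ballPotential G' R u + Real.log (1 + 1 / K) ≤ ballPotential G R u ∨
      ballPotential G' R v + Real.log (1 + 1 / K) ≤ ballPotential G R v := by
  by_contra! hcon
  -- Without a drop at either end, each ball exceeds `K` times the previous ball of the other end;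
  -- alternating between `u` and `v` gives growth past `K ^ R`.
  have hu : ∀ r < R, K * (hopBall G' r v).card < (hopBall G' (r + 1) u).card := by
    intro r hr
    by_contra! hle
    exact absurd (ballPotential_drop h huv hr (fun p => by have := hsep p; omega) hK hle)
      (not_le.2 hcon.1)
  have hv : ∀ r < R, K * (hopBall G' r u).card < (hopBall G' (r + 1) v).card := by
    intro r hr
    by_contra! hle
    refine absurd (ballPotential_drop h huv.symm hr (fun p => ?_) hK hle) (not_le.2 hcon.2)
    have := hsep p.reverse
    rw [SimpleGraph.Walk.length_reverse] at this
    omega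
  have hpow : ∀ r ≤ R, K ^ r ≤ (hopBall G' r u).card ∧ K ^ r ≤ (hopBall G' r v).card := by
    intro r
    induction r with
    | zero => intro _; rw [pow_zero]; exact ⟨one_le_card_hopBall G' 0 u, one_le_card_hopBall G' 0 v⟩
    | succ r ih =>
      intro hr
      obtain ⟨i1, i2⟩ := ih (by omega)
      rw [pow_succ']
      exact ⟨(mul_le_mul_of_nonneg_left i2 hK.le).trans (hu r hr).le,
        (mul_le_mul_of_nonneg_left i1 hK.le).trans (hv r hr).le⟩
  obtain ⟨r, rfl⟩ : ∃ r, R = r + 1 := ⟨R - 1, by omega⟩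
  have h1 := mul_le_mul_of_nonneg_left (hpow r (by omega)).2 hK.le
  rw [← pow_succ'] at h1
  linarith [hu r (by omega), card_hopBall_le G' (r + 1) u]

/-- Separating the edges of a matching lowers the total potential by a fixed amount per edge. -/
theorem sum_ballPotential_drop {G G' : SimpleGraph V} (h : G' ≤ G) (M : Finset (Sym2 V))
    (hM : IsMatching G (M : Set (Sym2 V))) {R : ℕ} (hR : 0 < R)
    (hsep : ∀ u v, s(u, v) ∈ M → ∀ p : G'.Walk u v, 2 * R ≤ p.length) {K : ℝ} (hK : 0 < K)
    (hKR : (Fintype.card V : ℝ) ≤ K ^ R) :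
    ∑ v, ballPotential G' R v + M.card * Real.log (1 + 1 / K) ≤ ∑ v, ballPotential G R v := by
  classical
  have hex : ∀ e : Sym2 V, ∃ w, e ∈ M → w ∈ e ∧
      Real.log (1 + 1 / K) ≤ ballPotential G R w - ballPotential G' R w := by
    intro e
    induction e using Sym2.inductionOn with
    | hf u v =>
      by_cases he : s(u, v) ∈ M
      · have huv : G.Adj u v := hM.1 he
        rcases exists_ballPotential_drop h huv hR (hsep u v he) hK hKR with h1 | h1
        · exact ⟨u, fun _ => ⟨by simp, by linarith⟩⟩
        · exact ⟨v, fun _ => ⟨by simp, by linarith⟩⟩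
      · exact ⟨u, fun h => absurd h he⟩
  choose f hf using hex
  -- Disjointness of matching edges lets no endpoint's drop be counted twice.
  have hinj : Set.InjOn f (M : Set (Sym2 V)) := by
    intro e he e' he' hee
    by_contra hne
    exact hM.2 e he e' he' hne (f e) ⟨(hf e he).1, hee ▸ (hf e' he').1⟩
  have h1 : M.card * Real.log (1 + 1 / K) ≤
      ∑ w ∈ M.image f, (ballPotential G R w - ballPotential G' R w) := by
    rw [Finset.sum_image hinj, ← nsmul_eq_mul]
    exact Finset.card_nsmul_le_sum _ _ _ fun e he => (hf e he).2
  have h2 : ∑ w ∈ M.image f, (ballPotential G R w - ballPotential G' R w) ≤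
      ∑ w, (ballPotential G R w - ballPotential G' R w) :=
    Finset.sum_le_sum_of_subset_of_nonneg (Finset.subset_univ _) fun w _ _ =>
      sub_nonneg.2 (ballPotential_mono h R w)
  rw [Finset.sum_sub_distrib (s := Finset.univ)] at h2
  linarith

end Balls

/-! ### From cut bounds to flows -/

section Routing

variable {W : Type*} [Fintype W] {G : SimpleGraph W}

open scoped Classical in
/-- The price of a path under edge prices `l`. -/
def pathCost (l : Sym2 W → ℝ) {u v : W} (P : G.Path u v) : ℝ :=
  ∑ x, l x * if x ∈ P.1.edges then 1 else 0

theorem pathCost_lt {l : Sym2 W → ℝ} {u v : W} {P : G.Path u v} {t θ : ℝ} (hθ : 0 < θ)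
    (ht : 0 < t) (hP : (P.1.length : ℝ) ≤ t) (hl : ∀ x ∈ P.1.edges, l x < θ) :
    pathCost l P < t * θ := by
  classical
  have h1 : pathCost l P = ∑ x ∈ P.1.edges.toFinset, l x := by
    simp [pathCost, ← List.mem_toFinset]
  rw [h1]
  rcases P.1.edges.toFinset.eq_empty_or_nonempty with h0 | h0
  · rw [h0, Finset.sum_empty]
    positivity
  · refine (Finset.sum_lt_sum_of_nonempty h0 fun x hx => hl x (List.mem_toFinset.1 hx)).trans_le ?_
    rw [Finset.sum_const, nsmul_eq_mul]
    refine mul_le_mul_of_nonneg_right (le_trans ?_ hP) hθ.le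
    exact_mod_cast (List.toFinset_card_le _).trans_eq P.1.length_edges

open scoped Classical in
theorem sum_path_indicator {a b : W} (Q : G.Path a b) (u v : W) :
    (∑ P : G.Path u v, if (⟨a, b, Q⟩ : Σ u v, G.Path u v) = ⟨u, v, P⟩ then (1 : ℝ) else 0) =
      if (a, b) = (u, v) then 1 else 0 := by
  by_cases h : (a, b) = (u, v)
  · obtain ⟨rfl, rfl⟩ := Prod.mk.inj h
    simp
  · rw [if_neg h]
    refine Finset.sum_eq_zero fun P _ => if_neg fun hP => h ?_
    cases hP
    rfl

theorem sum_paths [DecidableEq W] [DecidableRel G.Adj] (g : (Σ u v, G.Path u v) → ℝ) :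
    ∑ u, ∑ v, ∑ P : G.Path u v, g ⟨u, v, P⟩ = ∑ z, g z := by
  simp only [Fintype.sum_sigma]

/-- If no small edge set cuts all short connections of many edges of the matching, then against
any edge prices short cheap paths for the matching edges can be found. -/
theorem exists_cheap_paths {M : Set (Sym2 W)} (hM : IsMatching G M) {t : ℝ} (ht : 1 ≤ t)
    (hcut : ∀ M' C : Finset (Sym2 W), (M' : Set (Sym2 W)) ⊆ M →
      (∀ u v, s(u, v) ∈ M' → ∀ p : G.Walk u v, (p.length : ℝ) ≤ t → ∃ e ∈ p.edges, e ∈ C) →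
      2 * t * M'.card ≤ C.card)
    {o : Sym2 W → W × W} (ho : IsOrientation M o) [Fintype M] (l : Sym2 W → ℝ)
    (hl : ∀ e, 0 ≤ l e) :
    ∃ s : ∀ e : M, {P : G.Path (o e).1 (o e).2 // (P.1.length : ℝ) ≤ t},
      ∑ e, pathCost l (s e).1 ≤ 1 / 2 * ∑ x, l x := by
  classical
  have hne : ∀ e : M, Nonempty {P : G.Path (o e).1 (o e).2 // (P.1.length : ℝ) ≤ t} := by
    intro e
    have hadj : G.Adj (o e).1 (o e).2 := by
      rw [← SimpleGraph.mem_edgeSet, ho e e.2]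
      exact hM.1 e.2
    exact ⟨⟨SimpleGraph.Path.singleton hadj, by simpa [SimpleGraph.Path.singleton] using ht⟩⟩
  have hmin : ∀ e : M, ∃ P : {P : G.Path (o e).1 (o e).2 // (P.1.length : ℝ) ≤ t},
      ∀ Q : {P : G.Path (o e).1 (o e).2 // (P.1.length : ℝ) ≤ t},
        pathCost l P.1 ≤ pathCost l Q.1 := fun e => Finite.exists_min _
  choose s hs using hmin
  refine ⟨s, ?_⟩
  by_contra! hlt
  have ht0 : 0 < t := by linarith
  have hnonneg : ∀ e : M, 0 ≤ pathCost l (s e).1 := fun e =>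
    Finset.sum_nonneg fun x _ => mul_nonneg (hl x) (by split_ifs <;> simp)
  -- Dividing by `t` matches scales: a path of at most `t` edges, each priced below `θ`, costs less
  -- than `t * θ`. Hence the edges priced at least `θ` cut all short paths of the matching edges
  -- whose cheapest path costs at least `t * θ`.
  obtain ⟨θ, hθ, hcard⟩ := exists_threshold (Finset.univ : Finset M)
    (Finset.univ : Finset (Sym2 W)) (fun e => pathCost l (s e).1 / t) l
    (fun e _ => div_nonneg (hnonneg e) ht0.le) (fun x _ => hl x) (2 * t) (by
      rw [← Finset.sum_div]
      field_simp
      linarith)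
  set M' := (Finset.univ : Finset M).filter fun e => θ ≤ pathCost l (s e).1 / t with hM'
  have := hcut (M'.map (Function.Embedding.subtype _)) (Finset.univ.filter fun x => θ ≤ l x)
    (by intro e he; simp only [Finset.coe_map, Set.mem_image] at he; obtain ⟨e', -, rfl⟩ := he
        exact e'.2) (by
      intro u v huv p hp
      obtain ⟨e, he, heq⟩ := Finset.mem_map.1 huv
      replace heq : (e : Sym2 W) = s(u, v) := heq
      have hoe := ho e e.2
      by_contra! hno
      obtain ⟨q, hq, hqe⟩ : ∃ q : G.Walk (o e).1 (o e).2, q.length ≤ p.length ∧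
          q.edges ⊆ p.edges := by
        generalize (o e).1 = a, (o e).2 = b at hoe
        rw [heq] at hoe
        rcases Sym2.eq_iff.1 hoe with ⟨rfl, rfl⟩ | ⟨rfl, rfl⟩
        · exact ⟨p, le_rfl, fun _ => id⟩
        · exact ⟨p.reverse, by simp, by simp⟩
      have hqt : ((q.toPath : G.Path _ _).1.length : ℝ) ≤ t :=
        le_trans (by exact_mod_cast (q.length_bypass_le_length).trans hq) hp
      have h1 := hs e ⟨q.toPath, hqt⟩
      have h2 : pathCost l q.toPath < t * θ := pathCost_lt hθ ht0 hqt fun x hx => by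
        have := hno x (hqe (q.edges_bypass_subset_edges hx))
        simpa using this
      have h3 := (Finset.mem_filter.1 he).2
      rw [le_div_iff₀ ht0] at h3
      simp only at h1
      linarith)
  rw [Finset.card_map] at this
  linarith

/-- A minimax mixture of choices of one short path per matching edge loads every edge by at most
`1/2`; scaling by `d` gives the flow. -/
theorem matchingRoutable_of_cut {M : Set (Sym2 W)} (hM : IsMatching G M) {t : ℝ} (ht : 1 ≤ t)
    (hcut : ∀ M' C : Finset (Sym2 W), (M' : Set (Sym2 W)) ⊆ M →
      (∀ u v, s(u, v) ∈ M' → ∀ p : G.Walk u v, (p.length : ℝ) ≤ t → ∃ e ∈ p.edges, e ∈ C) →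
      2 * t * M'.card ≤ C.card)
    {d : ℝ} (hd : 0 ≤ d) : MatchingRoutable G M d (d / 2) t := by
  classical
  intro o ho
  let _ : Fintype M := Fintype.ofFinite M
  let S := ∀ e : M, {P : G.Path (o e).1 (o e).2 // (P.1.length : ℝ) ≤ t}
  obtain ⟨w, hw0, hw1, hw⟩ := exists_convex_combination_le (S := S)
    (fun s x => ∑ e, if x ∈ (s e).1.1.edges then (1 : ℝ) else 0) (1 / 2) (by
      intro l hl
      obtain ⟨s, hs⟩ := exists_cheap_paths hM ht hcut ho l hl
      refine ⟨s, le_trans (le_of_eq ?_) hs⟩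
      simp only [Finset.mul_sum, pathCost]
      exact Finset.sum_comm)
  let F : Flow G :=
    { val := fun {u v} P => d * ∑ s : S, w s * ∑ e,
        if (⟨_, _, (s e).1⟩ : Σ u v, G.Path u v) = ⟨u, v, P⟩ then 1 else 0
      nonneg := fun P => mul_nonneg hd (Finset.sum_nonneg fun s _ => mul_nonneg (hw0 s)
        (Finset.sum_nonneg fun e _ => by split_ifs <;> simp)) }
  have hFin : Fintype.ofFinite W = ‹Fintype W› := Subsingleton.elim _ _
  refine ⟨F, fun x _ => ?_, fun u v P hP => ?_, fun u v => ?_⟩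
  · have hcong : F.congestionOn x =
        d * ∑ s : S, w s * ∑ e, if x ∈ (s e).1.1.edges then (1 : ℝ) else 0 := by
      have h1 : F.congestionOn x = ∑ z : Σ u v, G.Path u v, ∑ s : S, ∑ e : M,
          if (⟨_, _, (s e).1⟩ : Σ u v, G.Path u v) = z then
            d * (w s * if x ∈ z.2.2.1.edges then 1 else 0) else 0 := by
        rw [← sum_paths]
        unfold Flow.congestionOn
        rw [hFin]
        refine Finset.sum_congr rfl fun u _ => Finset.sum_congr rfl fun v _ => ?_
        refine Finset.sum_congr (by congr!) fun P _ => ?_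
        by_cases hx : x ∈ P.1.edges <;>
          simp only [hx, F, Finset.mul_sum, if_true, if_false, mul_ite, mul_one, mul_zero, ite_self,
            Finset.sum_const_zero]
      rw [h1, Finset.sum_comm, Finset.mul_sum]
      refine Finset.sum_congr rfl fun s _ => ?_
      rw [Finset.sum_comm, Finset.mul_sum, Finset.mul_sum]
      exact Finset.sum_congr rfl fun e _ => by simp
    rw [hcong]
    linarith [mul_le_mul_of_nonneg_left (hw x) hd]
  · by_contra! hlong
    refine hP.ne' (mul_eq_zero_of_right _ (Finset.sum_eq_zero fun s _ => mul_eq_zero_of_right _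
      (Finset.sum_eq_zero fun e _ => if_neg fun h => ?_)))
    have hlen : ((s e).1.1.length : ℝ) = P.1.length :=
      congrArg (fun z : Σ u v, G.Path u v => (z.2.2.1.length : ℝ)) h
    linarith [(s e).2]
  · have hdem : F.demand u v = d * ∑ s : S, w s * ∑ e : M, if o e = (u, v) then (1 : ℝ) else 0 := by
      have h1 : F.demand u v = d * ∑ P : G.Path u v, ∑ s : S, w s * ∑ e : M,
          if (⟨_, _, (s e).1⟩ : Σ u v, G.Path u v) = ⟨u, v, P⟩ then 1 else 0 := by
        unfold Flow.demand
        rw [Finset.mul_sum, hFin]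
      rw [h1, Finset.sum_comm]
      refine congrArg _ (Finset.sum_congr rfl fun s _ => ?_)
      rw [← Finset.mul_sum, Finset.sum_comm]
      exact congrArg _ <| Finset.sum_congr rfl fun e _ => sum_path_indicator _ _ _
    have hcount : (∑ e : M, if o e = (u, v) then (1 : ℝ) else 0) =
        if ∃ e ∈ M, o e = (u, v) then 1 else 0 := by
      split_ifs with h
      · obtain ⟨e, he, hoe⟩ := h
        rw [Finset.sum_eq_single ⟨e, he⟩]
        · simp [hoe]
        · intro e' _ hne
          refine if_neg fun h' => hne (Subtype.ext ?_)
          change (e' : Sym2 W) = e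
          rw [← ho e' e'.2, ← ho e he, h', hoe]
        · simp
      · exact Finset.sum_eq_zero fun e _ => if_neg fun h' => h ⟨e, e.2, h'⟩
    rw [hdem, hcount, ← Finset.sum_mul, hw1, matchingDemand]
    split_ifs <;> simp

end Routing

/-! ### The extremal subgraph -/

section Extremal

variable {V : Type*} {H : SimpleGraph V}

/-- Walks that avoid `C` in a subgraph lift to the subgraph on its own vertex set. -/
theorem exists_walk_coe_of_deleteEdges (K : H.Subgraph) (C : Set (Sym2 V)) {a b : V}
    (p : (K.deleteEdges C).spanningCoe.Walk a b) (ha : a ∈ K.verts) :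
    ∃ (hb : b ∈ K.verts) (q : K.coe.Walk ⟨a, ha⟩ ⟨b, hb⟩), q.length = p.length ∧
      ∀ e ∈ q.edges, e.map Subtype.val ∉ C := by
  induction p with
  | nil => exact ⟨ha, .nil, rfl, by simp⟩
  | @cons u v w hadj p ih =>
    have huv : K.Adj u v ∧ s(u, v) ∉ C := by
      simpa [SimpleGraph.Subgraph.deleteEdges_adj] using hadj
    obtain ⟨hb, q, hq, hqC⟩ := ih huv.1.snd_mem
    have hcoe : K.coe.Adj ⟨u, ha⟩ ⟨v, huv.1.snd_mem⟩ := huv.1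
    refine ⟨hb, .cons hcoe q, by simp [hq], fun e he => ?_⟩
    rw [SimpleGraph.Walk.edges_cons, List.mem_cons] at he
    rcases he with rfl | he
    · exact huv.2
    · exact hqC e he

variable [Fintype V]

/-- The functional on subgraphs that is maximised: the number of edges, minus the weighted ball
potential, minus `m` per vertex. -/
def subgraphWeight (c m : ℝ) (R : ℕ) (K : H.Subgraph) : ℝ :=
  K.edgeSet.ncard - c * ∑ v, ballPotential K.spanningCoe R v - m * K.verts.ncard

theorem le_minDeg_of_subgraphWeight_max {c m : ℝ} (hc : 0 ≤ c) {R : ℕ} {K : H.Subgraph}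
    (hmax : ∀ K' : H.Subgraph, subgraphWeight c m R K' ≤ subgraphWeight c m R K)
    (hne : K.verts.Nonempty) : m ≤ minDeg K.coe := by
  classical
  let _ := Fintype.ofFinite K.verts
  have : Nonempty K.verts := hne.to_subtype
  obtain ⟨v, hv⟩ := K.coe.exists_minimal_degree_vertex
  have hdeg : minDeg K.coe = (K.coe.neighborSet v).ncard := by
    rw [← Nat.card_coe_set_eq, Nat.card_eq_fintype_card, SimpleGraph.card_neighborSet_eq_degree]
    unfold minDeg
    convert hv
  have hsub : K.edgeSet ⊆ (K.deleteVerts {v.1}).edgeSet ∪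
      (fun w : K.verts => s(v.1, w.1)) '' K.coe.neighborSet v := by
    intro e he
    induction e using Sym2.inductionOn with
    | hf x y =>
      have hxy : K.Adj x y := he
      by_cases hx : x = v.1
      · exact Or.inr ⟨⟨y, hxy.snd_mem⟩, by subst hx; exact hxy, by simp [hx]⟩
      by_cases hy : y = v.1
      · exact Or.inr ⟨⟨x, hxy.fst_mem⟩, by subst hy; exact hxy.symm, by simp [hy, Sym2.eq_swap]⟩
      left
      simp [hx, hy, hxy, hxy.fst_mem, hxy.snd_mem]
  have hcard : K.edgeSet.ncard ≤ (K.deleteVerts {v.1}).edgeSet.ncard + minDeg K.coe := by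
    rw [hdeg]
    exact (Set.ncard_le_ncard hsub).trans ((Set.ncard_union_le _ _).trans
      (Nat.add_le_add_left (Set.ncard_image_le) _))
  have hverts : (K.deleteVerts {v.1}).verts.ncard + 1 = K.verts.ncard := by
    rw [SimpleGraph.Subgraph.deleteVerts_verts]
    exact Set.ncard_sdiff_singleton_add_one v.2
  have hpot : ∑ x, ballPotential (K.deleteVerts {v.1}).spanningCoe R x ≤
      ∑ x, ballPotential K.spanningCoe R x := Finset.sum_le_sum fun x _ =>
    ballPotential_mono (SimpleGraph.Subgraph.spanningCoe_le_of_le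
      SimpleGraph.Subgraph.deleteVerts_le) R x
  have h1 := hmax (K.deleteVerts {v.1})
  unfold subgraphWeight at h1
  have h2 := mul_le_mul_of_nonneg_left hpot hc
  have h3 : (K.edgeSet.ncard : ℝ) ≤ (K.deleteVerts {v.1}).edgeSet.ncard + minDeg K.coe := by
    exact_mod_cast hcard
  have h4 : ((K.deleteVerts {v.1}).verts.ncard : ℝ) + 1 = K.verts.ncard := by
    exact_mod_cast hverts
  rw [← h4] at h1
  linarith

/-- Deleting `C` costs at most `|C|` edges, keeps the vertices, and gains `2t` per matching edge
through the potential. -/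
theorem le_card_cut_of_subgraphWeight_max {t : ℝ} (ht : 0 ≤ t) {R : ℕ} (hR : 0 < R)
    (hRt : 2 * (R : ℝ) ≤ t) {N : ℝ} (hN : 0 < N) (hNR : (Fintype.card V : ℝ) ≤ N ^ R) {m : ℝ}
    {K : H.Subgraph} (hmax : ∀ K' : H.Subgraph,
      subgraphWeight (2 * t / Real.log (1 + 1 / N)) m R K' ≤
        subgraphWeight (2 * t / Real.log (1 + 1 / N)) m R K)
    {M C : Finset (Sym2 K.verts)} (hM : IsMatching K.coe (M : Set (Sym2 K.verts)))
    (hsep : ∀ u v, s(u, v) ∈ M → ∀ p : K.coe.Walk u v, (p.length : ℝ) ≤ t →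
      ∃ e ∈ p.edges, e ∈ C) :
    2 * t * M.card ≤ C.card := by
  classical
  have hinj : Function.Injective (Sym2.map (Subtype.val : K.verts → V)) :=
    Sym2.map.injective Subtype.val_injective
  set K' := K.deleteEdges (C.image (Sym2.map Subtype.val) : Finset (Sym2 V)) with hK'
  have hle : K'.spanningCoe ≤ K.spanningCoe :=
    SimpleGraph.Subgraph.spanningCoe_le_of_le (SimpleGraph.Subgraph.deleteEdges_le _)
  have hmatch : IsMatching K.spanningCoe
      (M.image (Sym2.map Subtype.val) : Finset (Sym2 V)) := by
    rw [Finset.coe_image]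
    constructor
    · rintro _ ⟨e, he, rfl⟩
      have := hM.1 he
      induction e using Sym2.inductionOn with
      | hf x y => exact this
    · rintro _ ⟨e, he, rfl⟩ _ ⟨f, hf, rfl⟩ hef w ⟨hwe, hwf⟩
      obtain ⟨x, hx, rfl⟩ := Sym2.mem_map.1 hwe
      obtain ⟨y, hy, hxy⟩ := Sym2.mem_map.1 hwf
      obtain rfl := Subtype.val_injective hxy
      exact hM.2 e he f hf (fun h => hef (by rw [h])) y ⟨hx, hy⟩
  have hdrop := sum_ballPotential_drop hle _ hmatch hR (fun u v huv p => by
    by_contra! hp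
    obtain ⟨e, he, heq⟩ := Finset.mem_image.1 huv
    have hu : u ∈ K.verts := by
      have : u ∈ Sym2.map Subtype.val e := heq ▸ Sym2.mem_mk_left u v
      obtain ⟨x, -, rfl⟩ := Sym2.mem_map.1 this
      exact x.2
    obtain ⟨hv, q, hq, hqC⟩ := exists_walk_coe_of_deleteEdges K _ p hu
    have he' : e = s(⟨u, hu⟩, ⟨v, hv⟩) := hinj heq
    obtain ⟨f, hf, hfC⟩ := hsep _ _ (he' ▸ he) q (by
      rw [hq]
      have : (p.length : ℝ) ≤ 2 * R := by exact_mod_cast hp.le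
      linarith)
    exact hqC f hf (Finset.mem_coe.2 (Finset.mem_image_of_mem _ hfC))) hN hNR
  rw [Finset.card_image_of_injective _ hinj] at hdrop
  have hedges : (K.edgeSet.ncard : ℝ) ≤ K'.edgeSet.ncard + C.card := by
    have : K.edgeSet ⊆ K'.edgeSet ∪ (C.image (Sym2.map Subtype.val) : Finset (Sym2 V)) := by
      intro e he
      by_cases heC : e ∈ ((C.image (Sym2.map Subtype.val) : Finset (Sym2 V)) : Set (Sym2 V))
      · exact Or.inr heC
      · left
        induction e using Sym2.inductionOn with
        | hf x y =>
          exact (SimpleGraph.Subgraph.deleteEdges_adj _ _ _).2 ⟨he, heC⟩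
    have h1 := (Set.ncard_le_ncard this).trans (Set.ncard_union_le _ _)
    rw [Set.ncard_coe_finset] at h1
    exact_mod_cast h1.trans (Nat.add_le_add_left Finset.card_image_le _)
  have hlog : 0 < Real.log (1 + 1 / N) := Real.log_pos (by simp [hN])
  have h1 := hmax K'
  have hverts : K'.verts = K.verts := SimpleGraph.Subgraph.deleteEdges_verts ..
  unfold subgraphWeight at h1
  rw [hverts] at h1
  have h2 := mul_le_mul_of_nonneg_left hdrop
    (show 0 ≤ 2 * t / Real.log (1 + 1 / N) by positivity)
  have h3 : 2 * t / Real.log (1 + 1 / N) * (M.card * Real.log (1 + 1 / N)) = 2 * t * M.card := by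
    rw [mul_comm (M.card : ℝ), ← mul_assoc, div_mul_cancel₀ _ hlog.ne']
  rw [mul_add, h3] at h2
  linarith

theorem exists_subgraph_matchingRoutable (H : SimpleGraph V) {t : ℝ} (ht : 2 ≤ t) {R : ℕ}
    (hR : 0 < R) (hRt : 2 * (R : ℝ) ≤ t) {N : ℝ} (hN : 0 < N)
    (hNR : (Fintype.card V : ℝ) ≤ N ^ R) {m : ℝ} (hm : 0 ≤ m)
    (hedge : 2 * t / Real.log (1 + 1 / N) *
      (Fintype.card V * (R * Real.log (Fintype.card V))) + m * Fintype.card V <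
        H.edgeSet.ncard) :
    ∃ K : H.Subgraph, K.edgeSet.Nonempty ∧ m ≤ minDeg K.coe ∧
      ∀ M : Set (Sym2 K.verts), IsMatching K.coe M → MatchingRoutable K.coe M m (m / 2) t := by
  classical
  have hlog : 0 < Real.log (1 + 1 / N) := Real.log_pos (by simp [hN])
  have hc : 0 ≤ 2 * t / Real.log (1 + 1 / N) := by positivity
  obtain ⟨K, hmax⟩ := Finite.exists_max
    (subgraphWeight (H := H) (2 * t / Real.log (1 + 1 / N)) m R)
  have hpos : 0 < subgraphWeight (2 * t / Real.log (1 + 1 / N)) m R K := by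
    -- `H` itself has positive weight by `hedge`, whereas an edgeless subgraph has weight at most
    -- `0`.
    refine lt_of_lt_of_le ?_ (hmax ⊤)
    unfold subgraphWeight
    have h1 : ∑ v, ballPotential (⊤ : H.Subgraph).spanningCoe R v ≤
        Fintype.card V * (R * Real.log (Fintype.card V)) :=
      (Finset.sum_le_card_nsmul _ _ _ fun v _ => ballPotential_le _ R v).trans_eq (by simp)
    have h2 := mul_le_mul_of_nonneg_left h1 hc
    rw [SimpleGraph.Subgraph.verts_top, Set.ncard_univ, Nat.card_eq_fintype_card,
      SimpleGraph.Subgraph.edgeSet_top]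
    linarith
  have hne : K.edgeSet.Nonempty := by
    rw [Set.nonempty_iff_ne_empty]
    intro h0
    unfold subgraphWeight at hpos
    rw [h0, Set.ncard_empty, Nat.cast_zero] at hpos
    have h1 := mul_nonneg hc (Finset.sum_nonneg fun v (_ : v ∈ Finset.univ) =>
      ballPotential_nonneg K.spanningCoe R v)
    have h2 : 0 ≤ m * (K.verts.ncard : ℝ) := by positivity
    linarith
  have hvne : K.verts.Nonempty := by
    obtain ⟨e, he⟩ := hne
    induction e using Sym2.inductionOn with
    | hf x y => exact ⟨x, SimpleGraph.Subgraph.Adj.fst_mem (H := K) he⟩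
  refine ⟨K, hne, le_minDeg_of_subgraphWeight_max hc hmax hvne, fun M hM => ?_⟩
  refine matchingRoutable_of_cut hM (by linarith) (fun M' C hM' hsep => ?_) hm
  exact le_card_cut_of_subgraphWeight_max (by linarith) hR hRt hN hNR hmax
    ⟨hM'.trans hM.1, fun e he f hf => hM.2 e (hM' he) f (hM' hf)⟩ hsep

theorem card_mul_minDeg_le (H : SimpleGraph V) :
    Fintype.card V * minDeg H ≤ 2 * H.edgeSet.ncard := by
  classical
  have hFin : Fintype.ofFinite V = ‹Fintype V› := Subsingleton.elim _ _
  have h1 : minDeg H = H.minDegree := by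
    unfold minDeg
    rw [hFin]
  rw [← Nat.card_coe_set_eq, Nat.card_eq_fintype_card, ← SimpleGraph.edgeFinset_card,
    ← H.sum_degrees_eq_twice_card_edges, h1, ← smul_eq_mul, ← Finset.card_univ]
  exact Finset.card_nsmul_le_sum _ _ _ fun v _ => H.minDegree_le_degree v

end Extremal

end FlowRouting

end

/-! ### Choice of constants -/

theorem mainTheorem3 :
    ∃ Θ Θ' : ℝ, 0 < Θ ∧ 0 < Θ' ∧
      ∀ (t : ℝ), 2 ≤ t →
      ∀ (V : Type*) [Fintype V], 2 ≤ Fintype.card V →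
      ∀ (n φ δ δ' : ℝ),
        n = (Fintype.card V : ℝ) →
        φ = 1 / (2 * t * n ^ (Θ / t) * Real.log n) →
        δ = 4 * Θ' * t * Real.log n / φ ^ 2 →
        δ' = φ / (2 * t) * δ →
      ∀ H : SimpleGraph V, δ ≤ (FlowRouting.minDeg H : ℝ) →
        ∃ H' : H.Subgraph,
          H'.edgeSet.Nonempty ∧
          δ' ≤ (FlowRouting.minDeg H'.coe : ℝ) ∧
          ∀ M : Set (Sym2 H'.verts), FlowRouting.IsMatching H'.coe M →
            FlowRouting.MatchingRoutable H'.coe M δ' (δ' / 2) t := by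
  refine ⟨4, 1, by norm_num, by norm_num, ?_⟩
  intro t ht V _ hV n φ δ δ' hn hφ hδ hδ' H hH
  have hn2 : 2 ≤ n := by rw [hn]; exact_mod_cast hV
  have hlog : 0.69 < Real.log n := by
    have := Real.log_le_log (by norm_num) hn2
    linarith [Real.log_two_gt_d9]
  set L := Real.log n with hL
  set A := n ^ (4 / t) with hA
  have hA1 : 1 ≤ A := Real.one_le_rpow (by linarith) (by positivity)
  have hδ1 : δ = 16 * t ^ 3 * A ^ 2 * L ^ 3 := by
    rw [hδ, hφ]
    field_simp
    ring
  have hδ2 : δ' = 4 * t * A * L ^ 2 := by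
    rw [hδ', hδ1, hφ]
    field_simp
    ring
  have hR : 1 ≤ ⌊t / 2⌋₊ := Nat.le_floor (by push_cast; linarith)
  have hRle : (⌊t / 2⌋₊ : ℝ) ≤ t / 2 := Nat.floor_le (by positivity)
  -- Rounding down loses at most a factor `2`; this is why `Θ = 4` suffices for `n ≤ A ^ R`.
  have hRge : t / 4 ≤ ⌊t / 2⌋₊ := by
    have h1 := Nat.lt_floor_add_one (t / 2)
    have h2 : (1 : ℝ) ≤ ⌊t / 2⌋₊ := by exact_mod_cast hR
    linarith
  set R := ⌊t / 2⌋₊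
  have hR0 : (0 : ℝ) < R := by exact_mod_cast hR
  have hNR : (Fintype.card V : ℝ) ≤ A ^ R := by
    rw [← hn, hA, ← Real.rpow_natCast, ← Real.rpow_mul (by linarith)]
    refine Real.self_le_rpow_of_one_le (by linarith) ?_
    rw [div_mul_eq_mul_div, le_div_iff₀ (by linarith)]
    linarith
  refine FlowRouting.exists_subgraph_matchingRoutable H ht hR (by linarith) (by linarith) hNR
    (by rw [hδ2]; positivity) ?_
  rw [← hn, ← hL]
  have hg : 1 / (2 * A) ≤ Real.log (1 + 1 / A) := by
    have h1 := Real.one_sub_inv_le_log_of_pos (show 0 < 1 + 1 / A by positivity)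
    refine le_trans ?_ h1
    have : 1 - (1 + 1 / A)⁻¹ = 1 / (A + 1) := by field_simp; ring
    rw [this]
    exact one_div_le_one_div_of_le (by linarith) (by linarith)
  have hg' : 2 * t / Real.log (1 + 1 / A) ≤ 4 * t * A := by
    refine (div_le_div_of_nonneg_left (by linarith) (by positivity) hg).trans_eq ?_
    field_simp
    ring
  have hE : n * δ ≤ 2 * H.edgeSet.ncard := by
    refine (mul_le_mul_of_nonneg_left hH (by linarith)).trans ?_
    rw [hn]
    exact_mod_cast FlowRouting.card_mul_minDeg_le H
  have h1 : 2 * t / Real.log (1 + 1 / A) * (n * (R * L)) ≤ 4 * t * A * (n * (t / 2 * L)) := by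
    gcongr
  have hX : 0 < t * A * L * n := by positivity
  -- This is the required edge count after dividing by `t * A * L * n`: potential and vertex terms
  -- on the left, the bound `n * δ / 2` on the right.
  have hkey : 2 * t + 4 * L < 8 * t ^ 2 * A * L ^ 2 := by
    have h2 : t * L ≤ t * L * A := le_mul_of_one_le_right (by positivity) hA1
    have h3 : 1.38 < t * L := by nlinarith
    have h4 : t * L * (t * L) ≤ t * L * A * (t * L) :=
      mul_le_mul_of_nonneg_right h2 (by positivity)
    have h5 : t < 2 * (t * L) * (t * L) := by nlinarith
    have h6 : L < t * L * (t * L) := by nlinarith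
    linarith
  have := mul_lt_mul_of_pos_left hkey hX
  rw [hδ1] at hE
  rw [hδ2]
  nlinarith
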